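/- Let $\mu_0$ be a probability measure on a measurable space $(\Theta,\mathcal T)$, let $(S_1,\mathcal S_1),\dots,(S_K,\mathcal S_K)$ be measurable spaces, $S=S_1\times\dots\times S_K$ with the product $\sigma$-algebra, and let $\mathcal M_k$ be a Markov kernel from $\Theta$ to $S_k$ for each $k\in[K]=\{1,\dots,K\}$. For $A\subseteq[K]$ put $\mathcal M_A(\theta,dx_A)=\prod_{k\in A}\mathcal M_k(\theta,dx_k)$, $\mathcal M=\mathcal M_{[K]}$, and let $\mathcal M_{[K]\setminus A}\varphi$ denote the function of $(\theta,x_A)$ obtained by integrating $\varphi(\theta,x)$ over the components of $x$ outside $A$ with respect to $\mathcal M_{[K]\setminus A}(\theta,\cdot)$ (so $\mathcal M_\emptyset\varphi=\varphi$). Let $\mu(d\theta,dx)=\mu_0(d\theta)\prod_{k=1}^K\mathcal M_k(\theta,dx_k)$ on $\Theta\times S$, let $\varphi:\Theta\times S\to\mathbb R$, and write $\mu(\varphi)=\int\varphi\,d\mu$. For $N\ge1$ let $(\theta^m,X^{m,1},\dots,X^{m,N})_{m\ge1}$ be i.i.d., where $\theta^m$ has law $\mu_0$ and, given $\theta^m$,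 the $X^{m,n}=(X^{m,n}_1,\dots,X^{m,n}_K)$, $1\le n\le N$, are i.i.d. with law $\mathcal M(\theta^m,\cdot)$. For $M\ge1$ define $$\mu^{M,N}_\times(\varphi)=\frac1M\sum_{m=1}^M\frac1{N^K}\sum_{(n_1,\dots,n_K)\in\{1,\dots,N\}^K}\varphi\bigl(\theta^m,X^{m,n_1}_1,\dots,X^{m,n_K}_K\bigr).$$ (1) If $\varphi$ is $\mu$-integrable, then for all $N\ge1$: $\mathbb E[\mu^{M,N}_\times(\varphi)]=\mu(\varphi)$ for all $M\ge1$ (the estimator being integrable), and $\lim_{M\to\infty}\mu^{M,N}_\times(\varphi)=\mu(\varphi)$ almost surely. (2) If $\varphi\in L^2_\mu$, then for every $A\subseteq[K]$ the integral defining $\mathcal M_{[K]\setminus A}\varphi$ is well defined $\mu_0\otimes\mathcal M_A$-almost everywhere and $\mathcal M_{[K]\setminus A}\varphi\in L^2_{\mu_0\otimes\mathcal M_A}$. For all $N\ge1$ the number $$\sigma^2_{\times,N}(\varphi)=\mu_0\bigl([\mathcal M\varphi-\mu(\varphi)]^2\bigr)+\sum_{\emptyset\ne A\subseteq[K]}\frac1{N^{|A|}}\sum_{B\subseteq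 A}(-1)^{|A|-|B|}\mu_0\bigl(\mathcal M_B[\mathcal M_{[K]\setminus B}\varphi-\mathcal M\varphi]^2\bigr)$$ is non-negative, $$M^{1/2}\bigl[\mu^{M,N}_\times(\varphi)-\mu(\varphi)\bigr]\Rightarrow\mathcal N\bigl(0,\sigma^2_{\times,N}(\varphi)\bigr)\quad\text{in distribution as }M\to\infty,$$ and for all $M\ge1$ the estimator is square integrable with $\operatorname{Var}(\mu^{M,N}_\times(\varphi))=\sigma^2_{\times,N}(\varphi)/M$. -/

import Mathlib

open MeasureTheory ProbabilityTheory Filter Topology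

namespace PartialProduct

/-- The product kernel `θ ↦ ⨂ i, κ i θ` of finitely many Markov kernels is measurable in `θ`. -/
theorem measurable_pi_kernel {Θ ι : Type*} [MeasurableSpace Θ] [Fintype ι] {S : ι → Type*}
    [∀ i, MeasurableSpace (S i)] (κ : ∀ i, Kernel Θ (S i)) [∀ i, IsMarkovKernel (κ i)] :
    Measurable fun θ => Measure.pi fun i => κ i θ := by
  refine Measurable.measure_of_isPiSystem_of_isProbabilityMeasure
    generateFrom_pi.symm isPiSystem_pi ?_
  rintro _ ⟨s, hs, rfl⟩
  simp only [Measure.pi_pi]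
  exact Finset.measurable_prod _ fun i _ => (κ i).measurable_coe (hs i (Set.mem_univ i))

/-- The product kernel `θ ↦ ⨂ i, κ i θ` of a finite family of Markov kernels. -/
noncomputable def kernelPi {Θ ι : Type*} [MeasurableSpace Θ] [Fintype ι] {S : ι → Type*}
    [∀ i, MeasurableSpace (S i)] (κ : ∀ i, Kernel Θ (S i)) [∀ i, IsMarkovKernel (κ i)] :
    Kernel Θ (∀ i, S i) where
  toFun θ := Measure.pi fun i => κ i θ
  measurable' := measurable_pi_kernel κ

theorem kernelPi_apply {Θ ι : Type*} [MeasurableSpace Θ] [Fintype ι] {S : ι → Type*}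
    [∀ i, MeasurableSpace (S i)] (κ : ∀ i, Kernel Θ (S i)) [∀ i, IsMarkovKernel (κ i)] (θ : Θ) :
    kernelPi κ θ = Measure.pi fun i => κ i θ := rfl

instance instIsMarkovKernelKernelPi {Θ ι : Type*} [MeasurableSpace Θ] [Fintype ι] {S : ι → Type*}
    [∀ i, MeasurableSpace (S i)] (κ : ∀ i, Kernel Θ (S i)) [∀ i, IsMarkovKernel (κ i)] :
    IsMarkovKernel (kernelPi κ) where
  isProbabilityMeasure θ := by
    rw [kernelPi_apply]
    infer_instance

section

variable {K : ℕ} {Θ : Type*} [MeasurableSpace Θ] {S : Fin K → Type*} [∀ k, MeasurableSpace (S k)]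

/-- The partially factorized target `μ(dθ, dx) = μ₀(dθ) ∏ₖ κₖ(θ, dxₖ)` on `Θ × S₁ × ⋯ × S_K`. -/
noncomputable def target (μ₀ : Measure Θ) (κ : ∀ k, Kernel Θ (S k)) [∀ k, IsMarkovKernel (κ k)] :
    Measure (Θ × ∀ k, S k) :=
  μ₀ ⊗ₘ kernelPi κ

/-- The product kernel `κ_A(θ, dx_A) = ∏_{k ∈ A} κₖ(θ, dxₖ)` of the components indexed by `A`. -/
noncomputable def kernelOn (κ : ∀ k, Kernel Θ (S k)) [∀ k, IsMarkovKernel (κ k)]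
    (A : Finset (Fin K)) : Kernel Θ (∀ k : {k // k ∈ A}, S k) :=
  kernelPi fun k : {k // k ∈ A} => κ k

/-- The product kernel of the components that are not indexed by `A`. -/
noncomputable def kernelOff (κ : ∀ k, Kernel Θ (S k)) [∀ k, IsMarkovKernel (κ k)]
    (A : Finset (Fin K)) : Kernel Θ (∀ k : {k // k ∉ A}, S k) :=
  kernelPi fun k : {k // k ∉ A} => κ k

/-- The point of `∏ₖ Sₖ` with components `x` on `A` and `y` off `A`. -/
def merge (A : Finset (Fin K)) (x : ∀ k : {k // k ∈ A}, S k) (y : ∀ k : {k // k ∉ A}, S k) :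
    ∀ k, S k :=
  fun k => if h : k ∈ A then x ⟨k, h⟩ else y ⟨k, h⟩

/-- The function `κ_{[K] \ A}(φ)` of `(θ, x_A)`, obtained from `φ` by integrating out the components
of `x` that are not indexed by `A`. -/
noncomputable def integrateOff (κ : ∀ k, Kernel Θ (S k)) [∀ k, IsMarkovKernel (κ k)]
    (φ : Θ × (∀ k, S k) → ℝ) (A : Finset (Fin K)) (p : Θ × ∀ k : {k // k ∈ A}, S k) : ℝ :=
  ∫ y, φ (p.1, merge A p.2 y) ∂(kernelOff κ A p.1)

/-- The function `(κφ)(θ) = ∫ φ(θ, x) ∏ₖ κₖ(θ, dxₖ)`. -/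
noncomputable def kernelMean (κ : ∀ k, Kernel Θ (S k)) [∀ k, IsMarkovKernel (κ k)]
    (φ : Θ × (∀ k, S k) → ℝ) (θ : Θ) : ℝ :=
  ∫ x, φ (θ, x) ∂(kernelPi κ θ)

/-- The asymptotic variance
`σ² = μ₀([κφ - μ(φ)]²)
  + ∑_{∅ ≠ A ⊆ [K]} N^{-|A|} ∑_{B ⊆ A} (-1)^{|A|-|B|} μ₀(κ_B[κ_{[K] \ B}φ - κφ]²)`. -/
noncomputable def asymptoticVariance (μ₀ : Measure Θ) (κ : ∀ k, Kernel Θ (S k))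
    [∀ k, IsMarkovKernel (κ k)] (N : ℕ) (φ : Θ × (∀ k, S k) → ℝ) : ℝ :=
  ∫ θ, (kernelMean κ φ θ - ∫ p, φ p ∂(target μ₀ κ)) ^ 2 ∂μ₀ +
    ∑ A : Finset (Fin K) with A.Nonempty, 1 / (N : ℝ) ^ A.card *
      ∑ B ∈ A.powerset, (-1 : ℝ) ^ (A.card - B.card) *
        ∫ θ, ∫ x, (integrateOff κ φ B (θ, x) - kernelMean κ φ θ) ^ 2 ∂(kernelOn κ B θ) ∂μ₀

/-- The partially product-form estimator
`(1/M) ∑ₘ N^{-K} ∑_{n ∈ [N]^K} φ(θᵐ, X₁^{m,n₁}, …, X_K^{m,n_K})`, built from the first `M` terms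
of a sequence of draws `θᵐ` with `N` samples `X^{m,1}, …, X^{m,N}` each. -/
noncomputable def estimator {N : ℕ} (φ : Θ × (∀ k, S k) → ℝ) (M : ℕ) (θ : ℕ → Θ)
    (X : ℕ → Fin N → ∀ k, S k) : ℝ :=
  1 / (M : ℝ) * ∑ m ∈ Finset.range M,
    (1 / (N : ℝ) ^ K * ∑ n : Fin K → Fin N, φ (θ m, fun k => X m (n k) k))

/-- The sampling scheme: the blocks `(θᵐ, X^{m,1}, …, X^{m,N})` are independent across `m`, and in
each of them `θᵐ` has law `μ₀` and, given `θᵐ`, the `X^{m,1}, …, X^{m,N}` are i.i.d. with law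
`∏ₖ κₖ(θᵐ, dxₖ)`. -/
structure IsSample {Ω : Type*} [MeasurableSpace Ω] (P : Measure Ω) (μ₀ : Measure Θ)
    (κ : ∀ k, Kernel Θ (S k)) [∀ k, IsMarkovKernel (κ k)] {N : ℕ} (θ : ℕ → Ω → Θ)
    (X : ℕ → Fin N → Ω → ∀ k, S k) : Prop where
  hasLaw : ∀ m, HasLaw (fun ω => (θ m ω, fun n => X m n ω))
    (μ₀ ⊗ₘ kernelPi fun _ : Fin N => kernelPi κ) P
  indep : iIndepFun (fun m ω => (θ m ω, fun n => X m n ω)) P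

end

end PartialProduct

/-! The estimator is an average of `M` i.i.d. block averages (`blockAverage`), so the strong law,
the central limit theorem and additivity of variance reduce everything to the mean and variance of
one block.

Mean: a recombined point takes each coordinate from exactly one sample, so given `θ` it again has
the product law (`measurePreserving_recombine`), and together with `θ` it has law `target`.

Variance: split it by conditioning on `θ`. The conditional mean is `kernelMean`, which gives the
first term. For the conditional variance, expand the square over pairs of index vectors. If two
vectors agree exactly on `B`, their points share the coordinates in `B` and are otherwise
independent (`map_recombine_pair`), so the covariance is the second moment of the centred function
with the coordinates off `B` integrated out (`integral_mul_recombine`). Counting such pairs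
(`sum_agree_eq`) gives `B` the weight `N^{-|B|} (1 - 1/N)^{K - |B|}`. Expanding the second factor
over the sets `A ⊇ B` gives the signed double sum; `A = ∅` can be omitted since the term `B = ∅`
vanishes. Non-negativity holds because the number is the variance of a block
(`variance_blockAverage`). -/

namespace PartialProduct

/-! ### Square integrability and composition products -/

/-- Averaging over a Markov kernel maps `L²` to `L²`. -/
theorem memLp_two_integral_kernel {α β : Type*} [MeasurableSpace α] [MeasurableSpace β]
    {ρ : Measure α} [SFinite ρ] {η : Kernel α β} [IsMarkovKernel η] {f : α × β → ℝ}
    (hf : MemLp f 2 (ρ ⊗ₘ η)) : MemLp (fun a => ∫ b, f (a, b) ∂(η a)) 2 ρ := by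
  have hmeas : AEStronglyMeasurable (fun a => ∫ b, f (a, b) ∂(η a)) ρ := by
    refine ⟨fun a => ∫ b, hf.1.mk f (a, b) ∂(η a),
      hf.1.stronglyMeasurable_mk.integral_kernel_prod_right', ?_⟩
    filter_upwards [Measure.ae_ae_of_ae_compProd hf.1.ae_eq_mk] with a ha
    exact integral_congr_ae ha
  refine ⟨hmeas, ?_⟩
  rw [eLpNorm_lt_top_iff_lintegral_rpow_enorm_lt_top (by simp) (by simp)]
  have h2 : ∫⁻ p, ‖f p‖ₑ ^ (2 : ℝ) ∂(ρ ⊗ₘ η) < ⊤ := by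
    simpa using (eLpNorm_lt_top_iff_lintegral_rpow_enorm_lt_top (p := 2) (by simp) (by simp)).1 hf.2
  have hae : AEMeasurable (fun p => ‖f p‖ₑ ^ (2 : ℝ)) (ρ ⊗ₘ η) := hf.1.enorm.pow_const _
  have h3 : ∫⁻ p, ‖f p‖ₑ ^ (2 : ℝ) ∂(ρ ⊗ₘ η) = ∫⁻ a, ∫⁻ b, ‖f (a, b)‖ₑ ^ (2 : ℝ) ∂(η a) ∂ρ := by
    rw [lintegral_congr_ae hae.ae_eq_mk, Measure.lintegral_compProd hae.measurable_mk]
    refine lintegral_congr_ae ?_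
    filter_upwards [Measure.ae_ae_of_ae_compProd hae.ae_eq_mk] with a ha
    exact lintegral_congr_ae (ha.mono fun b hb => hb.symm)
  refine lt_of_le_of_lt ?_ (h3 ▸ h2)
  refine lintegral_mono_ae ?_
  filter_upwards [AEStronglyMeasurable.ae_of_compProd (f := fun a b => f (a, b)) hf.1] with a ha
  -- Jensen in the form `L¹ ≤ L²`, valid because `η a` is a probability measure.
  have h4 : ‖∫ b, f (a, b) ∂(η a)‖ₑ ≤ eLpNorm (fun b => f (a, b)) 2 (η a) := by
    refine (enorm_integral_le_lintegral_enorm _).trans ?_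
    rw [← eLpNorm_one_eq_lintegral_enorm]
    exact eLpNorm_le_eLpNorm_of_exponent_le (by norm_num) ha
  have h5 := eLpNorm_eq_lintegral_rpow_enorm_toReal (p := 2) (μ := η a) (f := fun b => f (a, b))
    (by simp) (by simp)
  simp only [ENNReal.toReal_ofNat] at h5 ⊢
  calc _ ≤ (eLpNorm (fun b => f (a, b)) 2 (η a)) ^ (2 : ℝ) := by gcongr
    _ = _ := by rw [h5, ← ENNReal.rpow_mul]; norm_num

theorem memLp_two_ae_of_compProd {α β : Type*} [MeasurableSpace α] [MeasurableSpace β]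
    {ρ : Measure α} [SFinite ρ] {η : Kernel α β} [IsMarkovKernel η] {f : α × β → ℝ}
    (hf : MemLp f 2 (ρ ⊗ₘ η)) : ∀ᵐ a ∂ρ, MemLp (fun b => f (a, b)) 2 (η a) := by
  filter_upwards [AEStronglyMeasurable.ae_of_compProd (f := fun a b => f (a, b)) hf.1,
    hf.integrable_sq.ae_of_compProd] with a h1 h2
  exact (memLp_two_iff_integrable_sq h1).2 h2

/-- Fibrewise preservation integrates to global preservation; this carries recombination from fixed
`θ` to a whole block. -/
theorem measurePreserving_compProd_map {α β γ : Type*} [MeasurableSpace α] [MeasurableSpace β]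
    [MeasurableSpace γ] (ρ : Measure α) [SFinite ρ] {η : Kernel α β} [IsMarkovKernel η]
    {ξ : Kernel α γ} [IsMarkovKernel ξ] {g : β → γ} (hg : ∀ a, MeasurePreserving g (η a) (ξ a))
    (hgm : Measurable g) :
    MeasurePreserving (fun p : α × β => (p.1, g p.2)) (ρ ⊗ₘ η) (ρ ⊗ₘ ξ) := by
  have hm : Measurable fun p : α × β => (p.1, g p.2) := by fun_prop
  refine ⟨hm, ?_⟩
  ext s hs
  rw [Measure.map_apply hm hs, Measure.compProd_apply (hm hs), Measure.compProd_apply hs]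
  refine lintegral_congr fun a => ?_
  rw [← (hg a).measure_preimage (measurable_prodMk_left hs).nullMeasurableSet]
  rfl

/-! ### Merging and recombining coordinates -/

section

variable {K : ℕ} {Θ : Type*} [MeasurableSpace Θ] {S : Fin K → Type*} [∀ k, MeasurableSpace (S k)]

theorem measurable_merge (A : Finset (Fin K)) :
    Measurable fun p : (∀ k : {k // k ∈ A}, S k) × (∀ k : {k // k ∉ A}, S k) =>
      merge A p.1 p.2 := by
  refine measurable_pi_lambda _ fun k => ?_
  unfold merge
  split_ifs <;> fun_prop

theorem measurePreserving_merge (ν : ∀ k, Measure (S k)) [∀ k, IsProbabilityMeasure (ν k)]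
    (A : Finset (Fin K)) :
    MeasurePreserving
      (fun p : (∀ k : {k // k ∈ A}, S k) × (∀ k : {k // k ∉ A}, S k) => merge A p.1 p.2)
      ((Measure.pi fun k : {k // k ∈ A} => ν k).prod (Measure.pi fun k : {k // k ∉ A} => ν k))
      (Measure.pi ν) := by
  convert! (measurePreserving_piEquivPiSubtypeProd ν (· ∈ A)).symm

instance instIsMarkovKernelKernelOn (κ : ∀ k, Kernel Θ (S k)) [∀ k, IsMarkovKernel (κ k)]
    (A : Finset (Fin K)) : IsMarkovKernel (kernelOn κ A) :=
  instIsMarkovKernelKernelPi _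

instance instIsMarkovKernelKernelOff (κ : ∀ k, Kernel Θ (S k)) [∀ k, IsMarkovKernel (κ k)]
    (A : Finset (Fin K)) : IsMarkovKernel (kernelOff κ A) :=
  instIsMarkovKernelKernelPi _

/-- Disintegration of the target over the components in `A`. -/
theorem measurePreserving_merge_target (μ₀ : Measure Θ) [SFinite μ₀]
    (κ : ∀ k, Kernel Θ (S k)) [∀ k, IsMarkovKernel (κ k)] (A : Finset (Fin K)) :
    MeasurePreserving
      (fun p : (Θ × ∀ k : {k // k ∈ A}, S k) × (∀ k : {k // k ∉ A}, S k) =>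
        (p.1.1, merge A p.1.2 p.2))
      ((μ₀ ⊗ₘ kernelOn κ A) ⊗ₘ (kernelOff κ A).comap Prod.fst measurable_fst)
      (target μ₀ κ) := by
  have hm : Measurable (fun p : (Θ × ∀ k : {k // k ∈ A}, S k) × (∀ k : {k // k ∉ A}, S k) =>
        (p.1.1, merge A p.1.2 p.2)) := by
    refine (measurable_fst.comp measurable_fst).prodMk ?_
    exact (measurable_merge A).comp ((measurable_snd.comp measurable_fst).prodMk measurable_snd)
  refine ⟨hm, ?_⟩
  ext s hs
  rw [Measure.map_apply hm hs, Measure.compProd_apply (hm hs), target, Measure.compProd_apply hs,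
    Measure.lintegral_compProd (Kernel.measurable_kernel_prodMk_left (hm hs))]
  refine lintegral_congr fun θ => ?_
  rw [kernelPi_apply, ← (measurePreserving_merge (fun k => κ k θ) A).measure_preimage
    (measurable_prodMk_left hs).nullMeasurableSet,
    Measure.prod_apply (measurable_merge A (measurable_prodMk_left hs))]
  rfl

/-- Under the `N`-fold product of `⨂ k, ν k`, the joint law of two recombined samples depends only
on the set of components on which the two index vectors agree: it is the law of two points that
share their components in that set and are otherwise independent. -/
theorem map_recombine_pair (ν : ∀ k, Measure (S k)) [∀ k, IsProbabilityMeasure (ν k)] {N : ℕ}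
    (n n' : Fin K → Fin N) (B : Finset (Fin K)) (hB : ∀ k, k ∈ B ↔ n k = n' k) :
    (Measure.pi fun _ : Fin N => Measure.pi ν).map
        (fun x => ((fun k => x (n k) k, fun k => x (n' k) k) : (∀ k, S k) × (∀ k, S k))) =
      ((Measure.pi fun k : {k // k ∈ B} => ν k).prod
        ((Measure.pi fun k : {k // k ∉ B} => ν k).prod
          (Measure.pi fun k : {k // k ∉ B} => ν k))).map
        (fun p => (merge B p.1 p.2.1, merge B p.1 p.2.2)) := by
  have hm1 : Measurable (fun x : Fin N → ∀ k, S k =>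
      ((fun k => x (n k) k, fun k => x (n' k) k) : (∀ k, S k) × (∀ k, S k))) := by fun_prop
  have hm2 : Measurable (fun p : (∀ k : {k // k ∈ B}, S k) ×
      (∀ k : {k // k ∉ B}, S k) × (∀ k : {k // k ∉ B}, S k) =>
      (merge B p.1 p.2.1, merge B p.1 p.2.2)) :=
    ((measurable_merge B).comp (measurable_fst.prodMk (measurable_fst.comp measurable_snd))).prodMk
      ((measurable_merge B).comp (measurable_fst.prodMk (measurable_snd.comp measurable_snd)))
  have := Measure.isProbabilityMeasure_map (μ := Measure.pi fun _ : Fin N => Measure.pi ν)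
    hm1.aemeasurable
  refine ext_of_generate_finite _ (generateFrom_eq_prod generateFrom_pi generateFrom_pi
    (.pi fun _ => isCountablySpanning_measurableSet)
    (.pi fun _ => isCountablySpanning_measurableSet)).symm (isPiSystem_pi.prod isPiSystem_pi) ?_ ?_
  · rintro _ ⟨_, ⟨s, hs, rfl⟩, _, ⟨t, ht, rfl⟩, rfl⟩
    have hst := (MeasurableSet.univ_pi fun k => hs k trivial).prod
      (MeasurableSet.univ_pi fun k => ht k trivial)
    rw [Measure.map_apply hm1 hst, Measure.map_apply hm2 hst]
    -- A box pulls back to a box: coordinate `k` of sample `j` is constrained only if `n` or `n'`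
    -- selects `j` at `k`.
    have h1 : (fun x : Fin N → ∀ k, S k =>
          ((fun k => x (n k) k, fun k => x (n' k) k) : (∀ k, S k) × (∀ k, S k))) ⁻¹'
            (Set.univ.pi s ×ˢ Set.univ.pi t) =
        Set.univ.pi fun j => Set.univ.pi fun k =>
          {a | (n k = j → a ∈ s k) ∧ (n' k = j → a ∈ t k)} := by
      ext x
      simp only [Set.mem_preimage, Set.mem_prod, Set.mem_univ_pi, Set.mem_ofPred_eq]
      refine ⟨fun h j k => ⟨?_, ?_⟩, fun h => ⟨fun k => (h _ k).1 rfl, fun k => (h _ k).2 rfl⟩⟩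
      · rintro rfl
        exact h.1 k
      · rintro rfl
        exact h.2 k
    have h2 : (fun p : (∀ k : {k // k ∈ B}, S k) ×
          (∀ k : {k // k ∉ B}, S k) × (∀ k : {k // k ∉ B}, S k) =>
          (merge B p.1 p.2.1, merge B p.1 p.2.2)) ⁻¹' (Set.univ.pi s ×ˢ Set.univ.pi t) =
        (Set.univ.pi fun k : {k // k ∈ B} => s k ∩ t k) ×ˢ
          ((Set.univ.pi fun k : {k // k ∉ B} => s k) ×ˢ
            (Set.univ.pi fun k : {k // k ∉ B} => t k)) := by
      ext p
      simp only [Set.mem_preimage, Set.mem_prod, Set.mem_univ_pi, Set.mem_inter_iff, merge]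
      refine ⟨fun h => ⟨fun k => ⟨?_, ?_⟩, fun k => ?_, fun k => ?_⟩,
        fun h => ⟨fun k => ?_, fun k => ?_⟩⟩
      · simpa [k.2] using h.1 k
      · simpa [k.2] using h.2 k
      · simpa [k.2] using h.1 k
      · simpa [k.2] using h.2 k
      · split_ifs with hk
        exacts [(h.1 ⟨k, hk⟩).1, h.2.1 ⟨k, hk⟩]
      · split_ifs with hk
        exacts [(h.1 ⟨k, hk⟩).2, h.2.2 ⟨k, hk⟩]
    rw [h1, h2, Measure.prod_prod, Measure.prod_prod]
    simp only [Measure.pi_pi]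
    -- With `k` outermost, the factors differing from `1` have `j = n k` or `j = n' k`: one factor
    -- `s k ∩ t k` for `k ∈ B`, two separate factors otherwise.
    rw [Finset.prod_comm, ← Finset.prod_mul_distrib,
      ← Fintype.prod_subtype_mul_prod_subtype (· ∈ B)]
    congr 1
    · refine Finset.prod_congr (by ext; simp) fun k _ => ?_
      have hk := (hB k).1 k.2
      rw [Finset.prod_eq_single (n k) (fun j _ hj => ?_) (by simp)]
      · refine congrArg (ν k) ?_
        ext a
        simp [hk]
      · simp [← hk, hj.symm]
    · refine Finset.prod_congr rfl fun k _ => ?_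
      have hk : n k ≠ n' k := fun h => k.2 ((hB k).2 h)
      rw [Finset.prod_eq_mul (n k) (n' k) hk (fun j _ hj => ?_) (by simp) (by simp)]
      · simp [hk, hk.symm]
      · simp [hj.1.symm, hj.2.symm]
  · rw [measure_univ, Measure.map_apply hm2 .univ]
    simp

/-- Coordinates are independent within a sample and across samples, so it does not matter which
sample supplies which coordinate. -/
theorem measurePreserving_recombine (ν : ∀ k, Measure (S k)) [∀ k, IsProbabilityMeasure (ν k)]
    {N : ℕ} (n : Fin K → Fin N) :
    MeasurePreserving (fun x : Fin N → ∀ k, S k => fun k => x (n k) k)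
      (Measure.pi fun _ : Fin N => Measure.pi ν) (Measure.pi ν) := by
  refine ⟨by fun_prop, ?_⟩
  refine Eq.symm (Measure.pi_eq fun s hs => ?_)
  rw [Measure.map_apply (by fun_prop) (.univ_pi hs)]
  have h1 : (fun x : Fin N → ∀ k, S k => fun k => x (n k) k) ⁻¹' (Set.univ.pi s) =
      Set.univ.pi fun j => Set.univ.pi fun k => {a | n k = j → a ∈ s k} := by
    ext x
    simp only [Set.mem_preimage, Set.mem_univ_pi, Set.mem_ofPred_eq]
    refine ⟨fun h j k => ?_, fun h k => h _ k rfl⟩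
    rintro rfl
    exact h k
  rw [h1]
  simp only [Measure.pi_pi]
  rw [Finset.prod_comm]
  refine Finset.prod_congr rfl fun k _ => ?_
  rw [Finset.prod_eq_single (n k) (fun j _ hj => ?_) (by simp)]
  · simp
  · simp [hj.symm]

end
-- Combinatorics of agreement sets
/-- Sum over pairs of index vectors, grouped by the set of components on which they agree. -/
theorem sum_agree_eq {K N : ℕ} (h : Finset (Fin K) → ℝ) :
    ∑ n : Fin K → Fin N, ∑ n' : Fin K → Fin N,
        h (Finset.univ.filter fun k => n k = n' k) =
      ∑ B : Finset (Fin K), ((N : ℝ) ^ B.card * ((N : ℝ) * (N - 1)) ^ (K - B.card)) * h B := by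
  rw [← Fintype.sum_prod_type' (f := fun n n' : Fin K → Fin N =>
    h (Finset.univ.filter fun k => n k = n' k)),
    ← (Equiv.arrowProdEquivProdArrow (Fin K) (fun _ => Fin N) (fun _ => Fin N)).sum_comp]
  rw [← Finset.sum_fiberwise_of_maps_to (s := Finset.univ) (t := Finset.univ)
    (g := fun q : Fin K → Fin N × Fin N => Finset.univ.filter fun k => (q k).1 = (q k).2)
    (fun _ _ => Finset.mem_univ _)]
  refine Finset.sum_congr rfl fun B _ => ?_
  -- Prescribing the agreement set is a coordinatewise condition: the pair `q k` lies on the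
  -- diagonal for `k ∈ B` and off it otherwise.
  have h1 : (Finset.univ.filter fun q : Fin K → Fin N × Fin N =>
      (Finset.univ.filter fun k => (q k).1 = (q k).2) = B) =
      Fintype.piFinset fun k => if k ∈ B then (Finset.univ : Finset (Fin N)).diag
        else (Finset.univ : Finset (Fin N)).offDiag := by
    ext q
    simp only [Finset.mem_filter, Finset.mem_univ, true_and, Fintype.mem_piFinset,
      Finset.ext_iff]
    refine forall_congr' fun k => ?_
    by_cases hk : k ∈ B <;> simp [hk]
  have h2 : ((Fintype.piFinset fun k => if k ∈ B then (Finset.univ : Finset (Fin N)).diag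
        else (Finset.univ : Finset (Fin N)).offDiag).card : ℝ) =
      (N : ℝ) ^ B.card * ((N : ℝ) * (N - 1)) ^ (K - B.card) := by
    rw [Fintype.card_piFinset]
    push_cast
    rw [← Finset.prod_mul_prod_compl B]
    have hc : (Bᶜ).card = K - B.card := by simp [Finset.card_compl]
    rw [← hc, Finset.prod_congr rfl (g := fun _ => (N : ℝ)) (fun k hk => by simp [hk]),
      Finset.prod_congr (s₁ := Bᶜ) rfl (g := fun _ => (N : ℝ) * (N - 1)) (fun k hk => ?_)]
    · simp
    · rw [if_neg (Finset.mem_compl.1 hk), Finset.offDiag_card]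
      simp only [Finset.card_univ, Fintype.card_fin]
      rw [Nat.cast_sub (Nat.le_mul_self N)]
      push_cast
      ring
  rw [← h2, ← h1, ← nsmul_eq_mul, ← Finset.sum_const]
  refine Finset.sum_congr rfl fun q hq => ?_
  exact congrArg h (Finset.mem_filter.1 hq).2

/-- Summing `t^|A|` with signs over the sets `A ⊇ B`. -/
theorem sum_signed_pow_superset {K : ℕ} (t : ℝ) (B : Finset (Fin K)) :
    ∑ A : Finset (Fin K) with B ⊆ A, t ^ A.card * (-1) ^ (A.card - B.card) =
      t ^ B.card * (1 - t) ^ (K - B.card) := by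
  have hc : (Bᶜ).card = K - B.card := by simp [Finset.card_compl]
  have h1 := Finset.sum_pow_mul_eq_add_pow (-t) 1 Bᶜ
  rw [hc] at h1
  rw [show (1 - t) = -t + 1 by ring, ← h1, Finset.mul_sum]
  -- The sets `A ⊇ B` correspond to the subsets `A \ B` of `Bᶜ`, over which the binomial theorem for
  -- `(-t + 1)` runs.
  refine Finset.sum_nbij' (fun A => A \ B) (fun C => B ∪ C) ?_ ?_ ?_ ?_ ?_
  · intro A _
    simp only [Finset.mem_powerset]
    intro k hk
    simpa using (Finset.mem_sdiff.1 hk).2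
  · intro C _
    simp
  · intro A hA
    exact Finset.union_sdiff_of_subset (by simpa using hA)
  · intro C hC
    refine Finset.union_sdiff_cancel_left ?_
    exact (Finset.disjoint_left.2 fun k hk hk' => Finset.mem_compl.1 (Finset.mem_powerset.1 hC hk') hk)
  · intro A hA
    have hBA : B ⊆ A := by simpa using hA
    have h3 := Finset.card_sdiff_add_card_eq_card hBA
    have h4 : A.card - B.card = (A \ B).card := by omega
    rw [h4, ← h3, pow_add, neg_pow t]
    simp only [one_pow, mul_one]
    ring

/-- Exchange the sums and resum over `A ⊇ B`. The hypothesis `h0` makes the term `A = ∅` zero, so it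
can be restored beforehand. -/
theorem sum_nonempty_signed_eq {K : ℕ} (t : ℝ) (h : Finset (Fin K) → ℝ) (h0 : h ∅ = 0) :
    ∑ A : Finset (Fin K) with A.Nonempty, t ^ A.card *
        ∑ B ∈ A.powerset, (-1 : ℝ) ^ (A.card - B.card) * h B =
      ∑ B : Finset (Fin K), t ^ B.card * (1 - t) ^ (K - B.card) * h B := by
  rw [Finset.sum_filter_of_ne (p := fun A : Finset (Fin K) => A.Nonempty)]
  · simp_rw [← sum_signed_pow_superset, Finset.mul_sum, Finset.sum_mul]
    rw [Finset.sum_comm' (s := Finset.univ) (t := fun A : Finset (Fin K) => A.powerset)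
      (t' := Finset.univ) (s' := fun B => Finset.univ.filter fun A => B ⊆ A) (by simp)]
    refine Finset.sum_congr rfl fun B _ => Finset.sum_congr rfl fun A _ => ?_
    ring
  · intro A _ hA
    by_contra hne
    rw [Finset.not_nonempty_iff_eq_empty] at hne
    subst hne
    simp [h0] at hA

/-- At `x = N` both sides are the probability that two independent uniform index vectors agree
exactly on a given set of size `b`. -/
theorem recombine_weight_eq {x : ℝ} (hx : x ≠ 0) {b K : ℕ} (hb : b ≤ K) :
    (1 / x ^ K) ^ 2 * (x ^ b * (x * (x - 1)) ^ (K - b)) =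
      (1 / x) ^ b * (1 - 1 / x) ^ (K - b) := by
  obtain ⟨c, rfl⟩ := Nat.exists_eq_add_of_le hb
  rw [show (1 - 1 / x) = (x - 1) / x by field_simp]
  simp only [Nat.add_sub_cancel_left, div_pow, mul_pow, pow_add, one_pow]
  field_simp

/-! ### Variance of the recombination average for a fixed product measure -/

section

variable {K : ℕ} {S : Fin K → Type*} [∀ k, MeasurableSpace (S k)]

/-- Given the shared coordinates, the two factors are independent copies, so the product integrates
to a square. -/
theorem integral_mul_recombine (ν : ∀ k, Measure (S k)) [∀ k, IsProbabilityMeasure (ν k)] {N : ℕ}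
    (n n' : Fin K → Fin N) (B : Finset (Fin K)) (hB : ∀ k, k ∈ B ↔ n k = n' k)
    {f : (∀ k, S k) → ℝ} (hf : MemLp f 2 (Measure.pi ν)) :
    ∫ x, f (fun k => x (n k) k) * f (fun k => x (n' k) k)
        ∂(Measure.pi fun _ : Fin N => Measure.pi ν) =
      ∫ x, (∫ y, f (merge B x y) ∂(Measure.pi fun k : {k // k ∉ B} => ν k)) ^ 2
        ∂(Measure.pi fun k : {k // k ∈ B} => ν k) := by
  set μA := Measure.pi fun k : {k // k ∈ B} => ν k
  set μC := Measure.pi fun k : {k // k ∉ B} => ν k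
  have hm1 : Measurable (fun x : Fin N → ∀ k, S k =>
      ((fun k => x (n k) k, fun k => x (n' k) k) : (∀ k, S k) × (∀ k, S k))) := by fun_prop
  have hm2 : Measurable (fun p : (∀ k : {k // k ∈ B}, S k) ×
      (∀ k : {k // k ∉ B}, S k) × (∀ k : {k // k ∉ B}, S k) =>
      (merge B p.1 p.2.1, merge B p.1 p.2.2)) :=
    ((measurable_merge B).comp (measurable_fst.prodMk (measurable_fst.comp measurable_snd))).prodMk
      ((measurable_merge B).comp (measurable_fst.prodMk (measurable_snd.comp measurable_snd)))
  have hlaw := map_recombine_pair ν n n' B hB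
  have hp1 : MeasurePreserving Prod.fst ((Measure.pi fun _ : Fin N => Measure.pi ν).map
        (fun x => ((fun k => x (n k) k, fun k => x (n' k) k) : (∀ k, S k) × (∀ k, S k))))
      (Measure.pi ν) :=
    ⟨measurable_fst, by
      rw [Measure.map_map measurable_fst hm1]
      exact (measurePreserving_recombine ν n).map_eq⟩
  have hp2 : MeasurePreserving Prod.snd ((Measure.pi fun _ : Fin N => Measure.pi ν).map
        (fun x => ((fun k => x (n k) k, fun k => x (n' k) k) : (∀ k, S k) × (∀ k, S k))))
      (Measure.pi ν) :=
    ⟨measurable_snd, by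
      rw [Measure.map_map measurable_snd hm1]
      exact (measurePreserving_recombine ν n').map_eq⟩
  have haes : AEStronglyMeasurable (fun q : (∀ k, S k) × (∀ k, S k) => f q.1 * f q.2)
      ((Measure.pi fun _ : Fin N => Measure.pi ν).map
        (fun x => ((fun k => x (n k) k, fun k => x (n' k) k) : (∀ k, S k) × (∀ k, S k)))) :=
    (hf.1.comp_measurePreserving hp1).mul (hf.1.comp_measurePreserving hp2)
  -- Both marginals of the pair law are `Measure.pi ν`, so the product is integrable as a product of
  -- two `L²` functions.
  have hint : Integrable (fun q : (∀ k, S k) × (∀ k, S k) => f q.1 * f q.2)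
      ((Measure.pi fun _ : Fin N => Measure.pi ν).map
        (fun x => ((fun k => x (n k) k, fun k => x (n' k) k) : (∀ k, S k) × (∀ k, S k)))) :=
    (hf.comp_measurePreserving hp1).integrable_mul (hf.comp_measurePreserving hp2)
  rw [← integral_map (φ := fun x : Fin N → ∀ k, S k =>
      ((fun k => x (n k) k, fun k => x (n' k) k) : (∀ k, S k) × (∀ k, S k)))
      (f := fun q => f q.1 * f q.2) hm1.aemeasurable haes]
  rw [hlaw] at haes hint ⊢
  rw [integral_map hm2.aemeasurable haes]
  refine (integral_prod (fun p : (∀ k : {k // k ∈ B}, S k) ×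
      (∀ k : {k // k ∉ B}, S k) × (∀ k : {k // k ∉ B}, S k) =>
      f (merge B p.1 p.2.1) * f (merge B p.1 p.2.2))
    ((integrable_map_measure haes hm2.aemeasurable).1 hint)).trans ?_
  refine integral_congr_ae (ae_of_all _ fun x => ?_)
  simp only
  rw [sq]
  exact integral_prod_mul (fun y => f (merge B x y)) (fun y => f (merge B x y))

/-- The variance of the average over all recombinations of `N` i.i.d. samples from a product
probability measure. -/
theorem integral_sq_recombine_average_sub (ν : ∀ k, Measure (S k))
    [∀ k, IsProbabilityMeasure (ν k)] {N : ℕ} (hN : 0 < N)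
    {f : (∀ k, S k) → ℝ} (hf : MemLp f 2 (Measure.pi ν)) :
    ∫ x, (1 / (N : ℝ) ^ K * ∑ n : Fin K → Fin N, f (fun k => x (n k) k) -
          ∫ z, f z ∂(Measure.pi ν)) ^ 2 ∂(Measure.pi fun _ : Fin N => Measure.pi ν) =
      ∑ B : Finset (Fin K), (1 / (N : ℝ)) ^ B.card * (1 - 1 / (N : ℝ)) ^ (K - B.card) *
        ∫ x, (∫ y, f (merge B x y) ∂(Measure.pi fun k : {k // k ∉ B} => ν k) -
          ∫ z, f z ∂(Measure.pi ν)) ^ 2 ∂(Measure.pi fun k : {k // k ∈ B} => ν k) := by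
  have hN0 : (N : ℝ) ≠ 0 := by positivity
  set m := ∫ z, f z ∂(Measure.pi ν)
  have hg : MemLp (fun z => f z - m) 2 (Measure.pi ν) := hf.sub (memLp_const m)
  have hgn (n : Fin K → Fin N) := hg.comp_measurePreserving (measurePreserving_recombine ν n)
  -- There are `N ^ K` index vectors, so centring the average amounts to centring each summand.
  have hpt (x : Fin N → ∀ k, S k) :
      (1 / (N : ℝ) ^ K * ∑ n : Fin K → Fin N, f (fun k => x (n k) k) - m) ^ 2 =
      (1 / (N : ℝ) ^ K) ^ 2 * ∑ n : Fin K → Fin N, ∑ n' : Fin K → Fin N,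
        (f (fun k => x (n k) k) - m) * (f (fun k => x (n' k) k) - m) := by
    rw [← Finset.sum_mul_sum, ← sq, ← mul_pow]
    congr 1
    rw [Finset.sum_sub_distrib]
    simp only [Finset.sum_const, Finset.card_univ, Fintype.card_fun, Fintype.card_fin, nsmul_eq_mul]
    push_cast
    field_simp
  have hint (n n' : Fin K → Fin N) : Integrable (fun x : Fin N → ∀ k, S k =>
      (f (fun k => x (n k) k) - m) * (f (fun k => x (n' k) k) - m))
      (Measure.pi fun _ : Fin N => Measure.pi ν) := (hgn n).integrable_mul (hgn n')
  simp_rw [hpt]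
  rw [integral_const_mul, integral_finsetSum _ fun n _ => integrable_finsetSum _ fun n' _ => hint n n']
  simp_rw [integral_finsetSum _ fun n' _ => hint _ n']
  have h1 (n n' : Fin K → Fin N) := integral_mul_recombine ν n n'
    (Finset.univ.filter fun k => n k = n' k) (by simp) hg
  simp_rw [h1]
  rw [sum_agree_eq (N := N) (fun B =>
    ∫ x, (∫ y, (f (merge B x y) - m) ∂(Measure.pi fun k : {k // k ∉ B} => ν k)) ^ 2
        ∂(Measure.pi fun k : {k // k ∈ B} => ν k)), Finset.mul_sum]
  refine Finset.sum_congr rfl fun B _ => ?_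
  have hB : B.card ≤ K := by simpa using Finset.card_le_univ B
  rw [← mul_assoc, recombine_weight_eq hN0 hB]
  congr 1
  have hF : Integrable (fun p : (∀ k : {k // k ∈ B}, S k) × (∀ k : {k // k ∉ B}, S k) =>
      f (merge B p.1 p.2)) ((Measure.pi fun k : {k // k ∈ B} => ν k).prod
        (Measure.pi fun k : {k // k ∉ B} => ν k)) :=
    (hf.comp_measurePreserving (measurePreserving_merge ν B)).integrable (by norm_num)
  refine integral_congr_ae ?_
  filter_upwards [hF.prod_right_ae] with x hx
  rw [integral_sub hx (integrable_const m)]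
  simp

end
-- Bias-variance decomposition; applied on each fibre, it yields the law of total variance.
theorem integral_sub_sq_eq {α : Type*} [MeasurableSpace α] {ρ : Measure α} [IsProbabilityMeasure ρ]
    {Y : α → ℝ} (hY : MemLp Y 2 ρ) (c : ℝ) :
    ∫ x, (Y x - c) ^ 2 ∂ρ = ∫ x, (Y x - ∫ z, Y z ∂ρ) ^ 2 ∂ρ + (∫ z, Y z ∂ρ - c) ^ 2 := by
  set m := ∫ z, Y z ∂ρ with hm
  have hYi : Integrable Y ρ := hY.integrable (by norm_num)
  have h1 : Integrable (fun x => (Y x - m) ^ 2) ρ := (hY.sub (memLp_const m)).integrable_sq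
  have h2 : Integrable (fun x => 2 * (m - c) * (Y x - m)) ρ :=
    (hYi.sub (integrable_const m)).const_mul _
  have h12 : Integrable (fun x => (Y x - m) ^ 2 + 2 * (m - c) * (Y x - m)) ρ := h1.add h2
  have h3 (x : α) : (Y x - c) ^ 2 = (Y x - m) ^ 2 + 2 * (m - c) * (Y x - m) + (m - c) ^ 2 := by ring
  simp_rw [h3]
  rw [integral_add h12 (integrable_const _), integral_add h1 h2, integral_const_mul,
    integral_sub hYi (integrable_const m)]
  simp [← hm]

/-! ### Mean and variance of one block -/

section

variable {K : ℕ} {Θ : Type*} [MeasurableSpace Θ] {S : Fin K → Type*} [∀ k, MeasurableSpace (S k)]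

instance instIsProbabilityMeasureTarget (μ₀ : Measure Θ) [IsProbabilityMeasure μ₀]
    (κ : ∀ k, Kernel Θ (S k)) [∀ k, IsMarkovKernel (κ k)] : IsProbabilityMeasure (target μ₀ κ) := by
  unfold target
  infer_instance

theorem integrable_ae_integrateOff {μ₀ : Measure Θ} [IsProbabilityMeasure μ₀]
    {κ : ∀ k, Kernel Θ (S k)} [∀ k, IsMarkovKernel (κ k)] {φ : Θ × (∀ k, S k) → ℝ}
    (hφ : Integrable φ (target μ₀ κ)) (A : Finset (Fin K)) :
    ∀ᵐ p ∂(μ₀ ⊗ₘ kernelOn κ A),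
      Integrable (fun y => φ (p.1, merge A p.2 y)) (kernelOff κ A p.1) :=
  (((measurePreserving_merge_target μ₀ κ A).integrable_comp hφ.1).2 hφ).ae_of_compProd

theorem memLp_integrateOff {μ₀ : Measure Θ} [IsProbabilityMeasure μ₀]
    {κ : ∀ k, Kernel Θ (S k)} [∀ k, IsMarkovKernel (κ k)] {φ : Θ × (∀ k, S k) → ℝ}
    (hφ : MemLp φ 2 (target μ₀ κ)) (A : Finset (Fin K)) :
    MemLp (integrateOff κ φ A) 2 (μ₀ ⊗ₘ kernelOn κ A) :=
  memLp_two_integral_kernel (hφ.comp_measurePreserving (measurePreserving_merge_target μ₀ κ A))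

/-- Integrating out every coordinate leaves the mean, so nothing remains after centring. This
supplies the hypothesis `h0` of `sum_nonempty_signed_eq`. -/
theorem integral_sq_integral_merge_empty_sub (ν : ∀ k, Measure (S k))
    [∀ k, IsProbabilityMeasure (ν k)] {f : (∀ k, S k) → ℝ} (hf : Integrable f (Measure.pi ν)) :
    ∫ x, (∫ y, f (merge ∅ x y) ∂(Measure.pi fun k : {k // k ∉ (∅ : Finset (Fin K))} => ν k) -
      ∫ z, f z ∂(Measure.pi ν)) ^ 2
      ∂(Measure.pi fun k : {k // k ∈ (∅ : Finset (Fin K))} => ν k) = 0 := by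
  have hmp := measurePreserving_merge ν ∅
  have h1 := integral_prod _ ((hmp.integrable_comp hf.1).2 hf)
  have h2 := integral_map hmp.measurable.aemeasurable (hmp.map_eq.symm ▸ hf.1)
  rw [hmp.map_eq] at h2
  have h3 := h2.trans h1
  have h4 : (Measure.pi fun k : {k // k ∈ (∅ : Finset (Fin K))} => ν k) =
      Measure.dirac isEmptyElim := Measure.pi_of_empty _ _
  rw [h4, integral_dirac] at h3 ⊢
  rw [h3]
  simp

theorem integral_recombine_average (ν : ∀ k, Measure (S k)) [∀ k, IsProbabilityMeasure (ν k)]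
    {N : ℕ} (hN : 0 < N) {f : (∀ k, S k) → ℝ} (hf : Integrable f (Measure.pi ν)) :
    ∫ x, 1 / (N : ℝ) ^ K * ∑ n : Fin K → Fin N, f (fun k => x (n k) k)
        ∂(Measure.pi fun _ : Fin N => Measure.pi ν) = ∫ z, f z ∂(Measure.pi ν) := by
  have h1 (n : Fin K → Fin N) : ∫ x : Fin N → ∀ k, S k, f (fun k => x (n k) k)
      ∂(Measure.pi fun _ : Fin N => Measure.pi ν) = ∫ z, f z ∂(Measure.pi ν) := by
    have hmp := measurePreserving_recombine ν n
    have h2 := integral_map hmp.measurable.aemeasurable (hmp.map_eq.symm ▸ hf.1)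
    rw [hmp.map_eq] at h2
    exact h2.symm
  have h3 (n : Fin K → Fin N) : Integrable (fun x : Fin N → ∀ k, S k => f (fun k => x (n k) k))
      (Measure.pi fun _ : Fin N => Measure.pi ν) :=
    ((measurePreserving_recombine ν n).integrable_comp hf.1).2 hf
  rw [integral_const_mul, integral_finsetSum _ fun n _ => h3 n]
  simp_rw [h1]
  have hN0 : (N : ℝ) ≠ 0 := by positivity
  simp only [Finset.sum_const, Finset.card_univ, Fintype.card_fun, Fintype.card_fin, nsmul_eq_mul]
  push_cast
  field_simp

/-- The average of `φ` over all recombinations of one block of samples. -/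
noncomputable def blockAverage {N : ℕ} (φ : Θ × (∀ k, S k) → ℝ) (p : Θ × (Fin N → ∀ k, S k)) : ℝ :=
  1 / (N : ℝ) ^ K * ∑ n : Fin K → Fin N, φ (p.1, fun k => p.2 (n k) k)

theorem measurePreserving_recombine_block (μ₀ : Measure Θ) [IsProbabilityMeasure μ₀]
    (κ : ∀ k, Kernel Θ (S k)) [∀ k, IsMarkovKernel (κ k)] {N : ℕ} (n : Fin K → Fin N) :
    MeasurePreserving
      (fun p : Θ × (Fin N → ∀ k, S k) => ((p.1, fun k => p.2 (n k) k) : Θ × ∀ k, S k))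
      (μ₀ ⊗ₘ kernelPi fun _ : Fin N => kernelPi κ) (target μ₀ κ) :=
  measurePreserving_compProd_map μ₀ (g := fun (x : Fin N → ∀ k, S k) k => x (n k) k)
    (fun θ => measurePreserving_recombine (fun k => κ k θ) n) (by fun_prop)

variable {μ₀ : Measure Θ} [IsProbabilityMeasure μ₀] {κ : ∀ k, Kernel Θ (S k)}
  [∀ k, IsMarkovKernel (κ k)] {φ : Θ × (∀ k, S k) → ℝ} {N : ℕ}

theorem integrable_blockAverage (hφ : Integrable φ (target μ₀ κ)) :
    Integrable (blockAverage φ) (μ₀ ⊗ₘ kernelPi fun _ : Fin N => kernelPi κ) :=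
  (integrable_finsetSum _ fun n _ =>
    ((measurePreserving_recombine_block μ₀ κ n).integrable_comp hφ.1).2 hφ).const_mul _

theorem memLp_blockAverage (hφ : MemLp φ 2 (target μ₀ κ)) :
    MemLp (blockAverage φ) 2 (μ₀ ⊗ₘ kernelPi fun _ : Fin N => kernelPi κ) :=
  (memLp_finsetSum _ fun n _ =>
    hφ.comp_measurePreserving (measurePreserving_recombine_block μ₀ κ n)).const_mul _

theorem integral_blockAverage (hN : 0 < N) (hφ : Integrable φ (target μ₀ κ)) :
    ∫ p, blockAverage φ p ∂(μ₀ ⊗ₘ kernelPi fun _ : Fin N => kernelPi κ) =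
      ∫ p, φ p ∂(target μ₀ κ) := by
  rw [Measure.integral_compProd (integrable_blockAverage hφ), target,
    Measure.integral_compProd hφ]
  refine integral_congr_ae ?_
  filter_upwards [Integrable.ae_of_compProd hφ] with θ hθ
  exact integral_recombine_average (fun k => κ k θ) hN hθ

/-- Law of total variance: the fibrewise second moment about the global mean `c` is the squared
deviation of `kernelMean` plus the conditional variance, and integrating over `θ` gives both parts
of the formula. -/
theorem variance_blockAverage (hN : 0 < N) (hφ : MemLp φ 2 (target μ₀ κ)) :
    Var[blockAverage φ; μ₀ ⊗ₘ kernelPi fun _ : Fin N => kernelPi κ] =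
      asymptoticVariance μ₀ κ N φ := by
  have hφi : Integrable φ (target μ₀ κ) := hφ.integrable (by norm_num)
  have hY := memLp_blockAverage (N := N) hφ
  set c := ∫ p, φ p ∂(target μ₀ κ) with hc
  have hae := memLp_two_ae_of_compProd (ρ := μ₀) (η := kernelPi κ) hφ
  have hmean : MemLp (kernelMean κ φ) 2 μ₀ := memLp_two_integral_kernel hφ
  let h (B : Finset (Fin K)) (θ : Θ) : ℝ :=
    ∫ x, (integrateOff κ φ B (θ, x) - kernelMean κ φ θ) ^ 2 ∂(kernelOn κ B θ)
  have hh (B : Finset (Fin K)) : Integrable (h B) μ₀ := by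
    have hfst : MeasurePreserving Prod.fst (μ₀ ⊗ₘ kernelOn κ B) μ₀ :=
      ⟨measurable_fst, Measure.fst_compProd μ₀ (kernelOn κ B)⟩
    exact ((memLp_integrateOff hφ B).sub
      (hmean.comp_measurePreserving hfst)).integrable_sq.integral_compProd
  have hh0 : ∫ θ, h ∅ θ ∂μ₀ = 0 := by
    refine integral_eq_zero_of_ae ?_
    filter_upwards [hae] with θ hθ
    exact integral_sq_integral_merge_empty_sub (fun k => κ k θ) (hθ.integrable (by norm_num))
  have hfib : ∀ᵐ θ ∂μ₀, ∫ x : Fin N → ∀ k, S k, (blockAverage φ (θ, x) - c) ^ 2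
        ∂(kernelPi (fun _ : Fin N => kernelPi κ) θ) =
      (kernelMean κ φ θ - c) ^ 2 +
        ∑ B : Finset (Fin K), (1 / (N : ℝ)) ^ B.card * (1 - 1 / (N : ℝ)) ^ (K - B.card) * h B θ := by
    filter_upwards [hae, memLp_two_ae_of_compProd hY] with θ hθ hYθ
    have h1 : ∫ x : Fin N → ∀ k, S k, blockAverage φ (θ, x)
        ∂(kernelPi (fun _ : Fin N => kernelPi κ) θ) = kernelMean κ φ θ :=
      integral_recombine_average (fun k => κ k θ) hN (hθ.integrable (by norm_num))
    rw [integral_sub_sq_eq hYθ, h1, add_comm]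
    congr 1
    exact integral_sq_recombine_average_sub (fun k => κ k θ) hN hθ
  have hsq1 : Integrable (fun p => (blockAverage φ p - c) ^ 2)
      (μ₀ ⊗ₘ kernelPi fun _ : Fin N => kernelPi κ) := (hY.sub (memLp_const c)).integrable_sq
  have hsq2 : Integrable (fun θ => (kernelMean κ φ θ - c) ^ 2) μ₀ :=
    (hmean.sub (memLp_const c)).integrable_sq
  rw [variance_eq_integral hY.1.aemeasurable, integral_blockAverage hN hφi, ← hc,
    Measure.integral_compProd hsq1, integral_congr_ae hfib,
    integral_add hsq2 (integrable_finsetSum _ fun B _ => (hh B).const_mul _),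
    integral_finsetSum _ fun B _ => (hh B).const_mul _]
  simp_rw [integral_const_mul]
  rw [← sum_nonempty_signed_eq (1 / (N : ℝ)) (fun B => ∫ θ, h B θ ∂μ₀) hh0]
  simp only [asymptoticVariance, one_div, inv_pow, h, ← hc]

end
-- From one block to the estimator: unbiasedness, strong law, variance, central limit theorem
section

variable {K : ℕ} {Θ : Type*} [MeasurableSpace Θ] {S : Fin K → Type*} [∀ k, MeasurableSpace (S k)]
  {μ₀ : Measure Θ} [IsProbabilityMeasure μ₀] {κ : ∀ k, Kernel Θ (S k)}
  [∀ k, IsMarkovKernel (κ k)] {φ : Θ × (∀ k, S k) → ℝ} {N : ℕ}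
  {Ω : Type*} [MeasurableSpace Ω] {P : Measure Ω}
  {θ : ℕ → Ω → Θ} {X : ℕ → Fin N → Ω → ∀ k, S k}

theorem estimator_eq_average_blockAverage (φ : Θ × (∀ k, S k) → ℝ) (M : ℕ) (θ : ℕ → Θ)
    (X : ℕ → Fin N → ∀ k, S k) :
    estimator φ M θ X =
      1 / (M : ℝ) * ∑ m ∈ Finset.range M, blockAverage φ (θ m, fun n => X m n) := rfl

theorem IsSample.iIndepFun_blockAverage (hs : IsSample P μ₀ κ θ X)
    (hφ : Integrable φ (target μ₀ κ)) :
    iIndepFun (fun m ω => blockAverage φ (θ m ω, fun n => X m n ω)) P :=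
  hs.indep.comp₀ (fun _ => blockAverage φ) (fun m => (hs.hasLaw m).aemeasurable) fun m => by
    rw [(hs.hasLaw m).map_eq]
    exact (integrable_blockAverage hφ).1.aemeasurable

theorem IsSample.identDistrib_blockAverage (hs : IsSample P μ₀ κ θ X)
    (hφ : Integrable φ (target μ₀ κ)) (m : ℕ) :
    IdentDistrib (fun ω => blockAverage φ (θ m ω, fun n => X m n ω)) (blockAverage φ) P
      (μ₀ ⊗ₘ kernelPi fun _ : Fin N => kernelPi κ) :=
  ((hs.hasLaw m).identDistrib HasLaw.id).comp_of_aemeasurable (u := blockAverage φ) (by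
    rw [(hs.hasLaw m).map_eq]
    exact (integrable_blockAverage hφ).1.aemeasurable)

theorem IsSample.integrable_estimator (hs : IsSample P μ₀ κ θ X)
    (hφ : Integrable φ (target μ₀ κ)) (M : ℕ) :
    Integrable (fun ω => estimator φ M (fun m => θ m ω) (fun m n => X m n ω)) P := by
  simp_rw [estimator_eq_average_blockAverage]
  exact (integrable_finsetSum _ fun m _ =>
    (hs.identDistrib_blockAverage hφ m).integrable_iff.2 (integrable_blockAverage hφ)).const_mul _

theorem IsSample.integral_estimator (hs : IsSample P μ₀ κ θ X) (hN : 0 < N)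
    (hφ : Integrable φ (target μ₀ κ)) {M : ℕ} (hM : 0 < M) :
    ∫ ω, estimator φ M (fun m => θ m ω) (fun m n => X m n ω) ∂P =
      ∫ p, φ p ∂(target μ₀ κ) := by
  simp_rw [estimator_eq_average_blockAverage]
  rw [integral_const_mul, integral_finsetSum _ fun m _ =>
    (hs.identDistrib_blockAverage hφ m).integrable_iff.2 (integrable_blockAverage hφ)]
  simp_rw [fun m => (hs.identDistrib_blockAverage hφ m).integral_eq, integral_blockAverage hN hφ]
  have hM0 : (M : ℝ) ≠ 0 := by positivity
  simp only [Finset.sum_const, Finset.card_range, nsmul_eq_mul]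
  field_simp

theorem IsSample.tendsto_estimator (hs : IsSample P μ₀ κ θ X) (hN : 0 < N)
    (hφ : Integrable φ (target μ₀ κ)) :
    ∀ᵐ ω ∂P, Tendsto
      (fun M : ℕ => estimator φ M (fun m => θ m ω) (fun m n => X m n ω))
      atTop (𝓝 (∫ p, φ p ∂(target μ₀ κ))) := by
  have hid := hs.identDistrib_blockAverage hφ
  have h1 := strong_law_ae (fun m ω => blockAverage φ (θ m ω, fun n => X m n ω))
    ((hid 0).integrable_iff.2 (integrable_blockAverage hφ))
    (fun i j hij => (hs.iIndepFun_blockAverage hφ).indepFun hij)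
    (fun m => (hid m).trans (hid 0).symm)
  rw [(hid 0).integral_eq, integral_blockAverage hN hφ] at h1
  simpa only [estimator_eq_average_blockAverage, one_div, smul_eq_mul] using h1

theorem IsSample.memLp_estimator (hs : IsSample P μ₀ κ θ X)
    (hφ : MemLp φ 2 (target μ₀ κ)) (M : ℕ) :
    MemLp (fun ω => estimator φ M (fun m => θ m ω) (fun m n => X m n ω)) 2 P := by
  simp_rw [estimator_eq_average_blockAverage]
  exact (memLp_finsetSum _ fun m _ =>
    (hs.identDistrib_blockAverage (hφ.integrable (by norm_num)) m).memLp_iff.2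
      (memLp_blockAverage hφ)).const_mul _

theorem IsSample.variance_estimator (hs : IsSample P μ₀ κ θ X) (hN : 0 < N)
    (hφ : MemLp φ 2 (target μ₀ κ)) {M : ℕ} (hM : 0 < M) :
    Var[fun ω => estimator φ M (fun m => θ m ω) (fun m n => X m n ω); P] =
      asymptoticVariance μ₀ κ N φ / M := by
  have hφi : Integrable φ (target μ₀ κ) := hφ.integrable (by norm_num)
  have hid := hs.identDistrib_blockAverage hφi
  have h1 := IndepFun.variance_sum (μ := P) (s := Finset.range M)
    (X := fun m ω => blockAverage φ (θ m ω, fun n => X m n ω))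
    (fun m _ => (hid m).memLp_iff.2 (memLp_blockAverage hφ))
    (fun i _ j _ hij => (hs.iIndepFun_blockAverage hφi).indepFun hij)
  simp_rw [fun m => (hid m).variance_eq, variance_blockAverage hN hφ] at h1
  simp_rw [estimator_eq_average_blockAverage]
  rw [variance_const_mul]
  have hM0 : (M : ℝ) ≠ 0 := by positivity
  have h2 : (fun ω => ∑ m ∈ Finset.range M, blockAverage φ (θ m ω, fun n => X m n ω)) =
      ∑ m ∈ Finset.range M, fun ω => blockAverage φ (θ m ω, fun n => X m n ω) := by
    ext ω
    simp
  rw [h2, h1]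
  simp only [Finset.sum_const, Finset.card_range, nsmul_eq_mul]
  field_simp

theorem IsSample.tendstoInDistribution_estimator [IsProbabilityMeasure P]
    (hs : IsSample P μ₀ κ θ X) (hN : 0 < N) (hφ : MemLp φ 2 (target μ₀ κ)) :
    TendstoInDistribution
      (fun (M : ℕ) ω => √(M : ℝ) *
        (estimator φ M (fun m => θ m ω) (fun m n => X m n ω) - ∫ p, φ p ∂(target μ₀ κ)))
      atTop (id : ℝ → ℝ) (fun _ => P)
      (gaussianReal 0 (asymptoticVariance μ₀ κ N φ).toNNReal) := by
  have hφi : Integrable φ (target μ₀ κ) := hφ.integrable (by norm_num)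
  have hid := hs.identDistrib_blockAverage hφi
  have h1 := tendstoInDistribution_inv_sqrt_mul_sum_sub (P := P)
    (X := fun m ω => blockAverage φ (θ m ω, fun n => X m n ω))
    (Y := (id : ℝ → ℝ)) (P' := gaussianReal 0 (asymptoticVariance μ₀ κ N φ).toNNReal)
    (by
      rw [(hid 0).variance_eq, variance_blockAverage hN hφ]
      exact HasLaw.id)
    ((hid 0).memLp_iff.2 (memLp_blockAverage hφ)) (hs.iIndepFun_blockAverage hφi)
    (fun m => (hid m).trans (hid 0).symm)
  rw [(hid 0).integral_eq, integral_blockAverage hN hφi] at h1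
  convert! h1 using 3 with M ω
  rw [estimator_eq_average_blockAverage]
  -- The two normalizations are compared for every `M`; at `M = 0` both expressions are zero.
  rcases Nat.eq_zero_or_pos M with rfl | hM
  · simp
  · have hM0 : (0 : ℝ) < M := by positivity
    have hsq : √(M : ℝ) ≠ 0 := (Real.sqrt_pos.2 hM0).ne'
    field_simp
    rw [Real.sq_sqrt hM0.le]

end
end PartialProduct

theorem theorem3 {K : ℕ} {Θ : Type*} [MeasurableSpace Θ] {S : Fin K → Type*}
    [∀ k, MeasurableSpace (S k)] (μ₀ : Measure Θ) [IsProbabilityMeasure μ₀]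
    (κ : ∀ k, Kernel Θ (S k)) [∀ k, IsMarkovKernel (κ k)] (φ : Θ × (∀ k, S k) → ℝ)
    {Ω : Type*} [MeasurableSpace Ω] (P : Measure Ω) [IsProbabilityMeasure P] :
    (Integrable φ (PartialProduct.target μ₀ κ) →
      ∀ (N : ℕ), 0 < N → ∀ (θ : ℕ → Ω → Θ) (X : ℕ → Fin N → Ω → ∀ k, S k),
        PartialProduct.IsSample P μ₀ κ θ X →
        (∀ M : ℕ, 0 < M →
          Integrable (fun ω => PartialProduct.estimator φ M (fun m => θ m ω)
            (fun m n => X m n ω)) P ∧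
          ∫ ω, PartialProduct.estimator φ M (fun m => θ m ω) (fun m n => X m n ω) ∂P =
            ∫ p, φ p ∂(PartialProduct.target μ₀ κ)) ∧
        ∀ᵐ ω ∂P, Tendsto
          (fun M : ℕ => PartialProduct.estimator φ M (fun m => θ m ω) (fun m n => X m n ω))
          atTop (𝓝 (∫ p, φ p ∂(PartialProduct.target μ₀ κ)))) ∧
    (MemLp φ 2 (PartialProduct.target μ₀ κ) →
      (∀ A : Finset (Fin K),
        (∀ᵐ p ∂(μ₀ ⊗ₘ PartialProduct.kernelOn κ A),
          Integrable (fun y => φ (p.1, PartialProduct.merge A p.2 y))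
            (PartialProduct.kernelOff κ A p.1)) ∧
        MemLp (PartialProduct.integrateOff κ φ A) 2 (μ₀ ⊗ₘ PartialProduct.kernelOn κ A)) ∧
      ∀ (N : ℕ), 0 < N → 0 ≤ PartialProduct.asymptoticVariance μ₀ κ N φ ∧
        ∀ (θ : ℕ → Ω → Θ) (X : ℕ → Fin N → Ω → ∀ k, S k),
          PartialProduct.IsSample P μ₀ κ θ X →
          TendstoInDistribution
            (fun (M : ℕ) ω => √(M : ℝ) *
              (PartialProduct.estimator φ M (fun m => θ m ω) (fun m n => X m n ω) -
                ∫ p, φ p ∂(PartialProduct.target μ₀ κ)))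
            atTop (id : ℝ → ℝ) (fun _ => P)
            (gaussianReal 0 (PartialProduct.asymptoticVariance μ₀ κ N φ).toNNReal) ∧
          ∀ M : ℕ, 0 < M →
            MemLp (fun ω => PartialProduct.estimator φ M (fun m => θ m ω)
              (fun m n => X m n ω)) 2 P ∧
            Var[fun ω => PartialProduct.estimator φ M (fun m => θ m ω)
              (fun m n => X m n ω); P] = PartialProduct.asymptoticVariance μ₀ κ N φ / M) := by
  refine ⟨fun hφ N hN θ X hs => ⟨fun M hM => ⟨hs.integrable_estimator hφ M,
    hs.integral_estimator hN hφ hM⟩, hs.tendsto_estimator hN hφ⟩, fun hφ => ⟨fun A =>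
    ⟨PartialProduct.integrable_ae_integrateOff (hφ.integrable (by norm_num)) A,
      PartialProduct.memLp_integrateOff hφ A⟩, fun N hN => ⟨?_, fun θ X hs =>
    ⟨hs.tendstoInDistribution_estimator hN hφ, fun M hM =>
      ⟨hs.memLp_estimator hφ M, hs.variance_estimator hN hφ hM⟩⟩⟩⟩⟩
  -- The block law exists by itself, so non-negativity requires no sample on `P`.
  rw [← PartialProduct.variance_blockAverage hN hφ]
  exact variance_nonneg _ _
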